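/- Let $n$ and $k$ be integers with $1\le k\le n$, and let $A,B\in\mathbb{C}^{n\times n}$ be (Hermitian) positive semidefinite matrices. For a Hermitian matrix $X\in\mathbb{C}^{n\times n}$ let $\lambda_1(X)\ge\lambda_2(X)\ge\cdots\ge\lambda_n(X)$ denote its eigenvalues, counted with multiplicity and listed in decreasing order. Then $$\prod_{t=n-k+1}^n\lambda_t(A+B)\ \ge\ \prod_{t=n-k+1}^n\bigl[\lambda_t(A)+\lambda_t(B)\bigr]\ \ge\ \prod_{t=n-k+1}^n\lambda_t(A)+\prod_{t=n-k+1}^n\lambda_t(B)+(2^k-2)\prod_{t=n-k+1}^n\bigl[\lambda_t(A)\lambda_t(B)\bigr]^{1/2}$$ and $$\prod_{t=1}^k\lambda_t(A+B)\ \ge\ \prod_{t=1}^k\lambda_t(A)+\prod_{t=1}^k\lambda_{n-t+1}(B)+(2^k-2)\prod_{t=1}^k\bigl[\lambda_t(A)\lambda_{n-t+1}(B)\bigr]^{1/2}.$$ -/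

import Mathlib

open scoped ComplexOrder

/-- The `t`-th largest eigenvalue `λ_t(A)` of an `n × n` complex Hermitian matrix `A`, counted with
multiplicity, so that `λ_1(A) ≥ λ_2(A) ≥ ⋯ ≥ λ_n(A)`. The index `t` runs through `1, …, n`;
the value is `0` outside this range. -/
noncomputable def eigenvalueDesc {n : ℕ} {A : Matrix (Fin n) (Fin n) ℂ} (hA : A.IsHermitian)
    (t : ℕ) : ℝ :=
  if h : 1 ≤ t ∧ t ≤ n then
    hA.eigenvalues₀ ⟨t - 1, by rw [Fintype.card_fin]; omega⟩
  else 0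

open Matrix

/-! Compressing `A + B` to the eigenvectors of its `j` smallest eigenvalues and taking traces shows,
by Cauchy interlacing, that the sum of the `j` smallest eigenvalues is superadditive. These bounds
for all `j ≤ k` pass to products (`prod_le_prod_of_partial_sums_le`), giving the first inequality.
The second is scalar: induction on `k` with AM-GM. For the third, compress to the top `k`
eigenvectors of `A`. The determinant of the compressed `A` is exact, interlacing bounds the
compressions of `B` from below and of `A + B` from above, and the first two inequalities apply in
size `k`. -/

/-! ### Scalar inequalities -/

/-- Abel summation as an induction: the last coefficient serves as the `γ` of the shorter sum. -/
theorem sum_mul_le_of_partial_sums_nonpos (c d : ℕ → ℝ) (k : ℕ) (γ : ℝ)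
    (hγ : 0 ≤ γ) (hc : ∀ i < k, γ ≤ c i) (hanti : ∀ i j, i ≤ j → j < k → c j ≤ c i)
    (hd : ∀ j ≤ k, ∑ i ∈ Finset.range j, d i ≤ 0) :
    ∑ i ∈ Finset.range k, c i * d i ≤ γ * ∑ i ∈ Finset.range k, d i := by
  induction k generalizing γ with
  | zero => simp
  | succ k ih =>
    have h1 := ih (c k) (hγ.trans (hc k k.lt_succ_self))
      (fun i hi => hanti i k hi.le k.lt_succ_self)
      (fun i j hij hj => hanti i j hij (hj.trans k.lt_succ_self))
      (fun j hj => hd j (hj.trans k.le_succ))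
    have h2 := mul_le_mul_of_nonpos_right (hc k k.lt_succ_self) (hd (k + 1) le_rfl)
    rw [Finset.sum_range_succ] at h2 ⊢
    rw [Finset.sum_range_succ]
    linarith

/-- Multiply the bounds `y ≤ x * exp ((y - x) / x)`: the total exponent is nonpositive by Abel
summation, since the weights `1 / x i` decrease. A vanishing `y i` is treated apart. -/
theorem prod_le_prod_of_partial_sums_le (x y : ℕ → ℝ) (k : ℕ)
    (hx : ∀ i j, i ≤ j → j < k → x i ≤ x j) (hy : ∀ i < k, 0 ≤ y i)
    (hxy : ∀ j ≤ k, ∑ i ∈ Finset.range j, y i ≤ ∑ i ∈ Finset.range j, x i) :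
    ∏ i ∈ Finset.range k, y i ≤ ∏ i ∈ Finset.range k, x i := by
  rcases Nat.eq_zero_or_pos k with rfl | hk
  · simp
  have h0 : y 0 ≤ x 0 := by simpa using hxy 1 hk
  by_cases hpos : ∀ i < k, 0 < y i
  · have hxpos : ∀ i < k, 0 < x i := fun i hi =>
      (hpos 0 hk).trans_le (h0.trans (hx 0 i i.zero_le hi))
    have hsum : ∑ i ∈ Finset.range k, (x i)⁻¹ * (y i - x i) ≤ 0 := by
      have h := sum_mul_le_of_partial_sums_nonpos (fun i => (x i)⁻¹) (fun i => y i - x i) k 0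
        le_rfl (fun i hi => (inv_pos.2 (hxpos i hi)).le)
        (fun i j hij hj => inv_anti₀ (hxpos i (hij.trans_lt hj)) (hx i j hij hj))
        (fun j hj => by rw [Finset.sum_sub_distrib]; linarith [hxy j hj])
      simpa using h
    have hfac : ∀ i ∈ Finset.range k, y i ≤ x i * Real.exp ((x i)⁻¹ * (y i - x i)) := by
      intro i hi
      have hxi := hxpos i (Finset.mem_range.1 hi)
      have h1 := mul_le_mul_of_nonneg_left (Real.add_one_le_exp ((x i)⁻¹ * (y i - x i))) hxi.le
      have h2 : x i * ((x i)⁻¹ * (y i - x i) + 1) = y i := by field_simp; ring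
      linarith
    calc ∏ i ∈ Finset.range k, y i
        ≤ ∏ i ∈ Finset.range k, x i * Real.exp ((x i)⁻¹ * (y i - x i)) :=
          Finset.prod_le_prod (fun i hi => hy i (Finset.mem_range.1 hi)) hfac
      _ = (∏ i ∈ Finset.range k, x i)
            * Real.exp (∑ i ∈ Finset.range k, (x i)⁻¹ * (y i - x i)) := by
          rw [Finset.prod_mul_distrib, Real.exp_sum]
      _ ≤ (∏ i ∈ Finset.range k, x i) * 1 :=
          mul_le_mul_of_nonneg_left (Real.exp_le_one_iff.2 hsum)
            (Finset.prod_nonneg fun i hi => (hxpos i (Finset.mem_range.1 hi)).le)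
      _ = _ := mul_one _
  · push Not at hpos
    obtain ⟨i, hi, hyi⟩ := hpos
    rw [Finset.prod_eq_zero (Finset.mem_range.2 hi) (le_antisymm hyi (hy i hi))]
    exact Finset.prod_nonneg fun j hj =>
      ((hy 0 hk).trans h0).trans (hx 0 j j.zero_le (Finset.mem_range.1 hj))

theorem two_mul_sqrt_mul_le_add {a b : ℝ} (ha : 0 ≤ a) (hb : 0 ≤ b) :
    2 * √(a * b) ≤ a + b := by
  rw [Real.sqrt_mul ha]
  nlinarith [sq_nonneg (√a - √b), Real.sq_sqrt ha, Real.sq_sqrt hb]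

/-- AM-GM on `a * Q + b * P` and on `a + b`. The map `c ↦ 2 * c + 2` sends `2 ^ k - 2` to `2 ^ (k +
1) - 2`, which drives the induction below. -/
theorem add_mul_add_add_sqrt_ge {a b P Q c : ℝ} (ha : 0 ≤ a) (hb : 0 ≤ b) (hP : 0 ≤ P)
    (hQ : 0 ≤ Q) (hc : 0 ≤ c) :
    a * P + b * Q + (2 * c + 2) * √((a * b) * (P * Q)) ≤
      (a + b) * (P + Q + c * √(P * Q)) := by
  have h1 := two_mul_sqrt_mul_le_add (mul_nonneg ha hQ) (mul_nonneg hb hP)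
  have h2 := mul_le_mul_of_nonneg_right (two_mul_sqrt_mul_le_add ha hb)
    (mul_nonneg hc (Real.sqrt_nonneg (P * Q)))
  have h3 : √(a * Q * (b * P)) = √(a * b) * √(P * Q) := by
    rw [← Real.sqrt_mul (mul_nonneg ha hb)]
    ring_nf
  rw [Real.sqrt_mul (mul_nonneg ha hb)]
  rw [h3] at h1
  linarith

theorem prod_add_ge_prod_add_prod_add_sqrt {ι : Type*} (s : Finset ι) (hs : s.Nonempty)
    (a b : ι → ℝ) (ha : ∀ i ∈ s, 0 ≤ a i) (hb : ∀ i ∈ s, 0 ≤ b i) :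
    (∏ i ∈ s, a i) + (∏ i ∈ s, b i)
        + ((2 : ℝ) ^ s.card - 2) * √((∏ i ∈ s, a i) * ∏ i ∈ s, b i) ≤
      ∏ i ∈ s, (a i + b i) := by
  induction hs using Finset.Nonempty.cons_induction with
  | singleton i => simp
  | cons i s hi hs ih =>
    simp only [Finset.mem_cons, forall_eq_or_imp] at ha hb
    have ih := ih ha.2 hb.2
    have hc : (0 : ℝ) ≤ 2 ^ s.card - 2 := by
      have := pow_le_pow_right₀ (one_le_two (α := ℝ)) hs.card_pos
      linarith
    have h1 := add_mul_add_add_sqrt_ge ha.1 hb.1 (Finset.prod_nonneg ha.2)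
      (Finset.prod_nonneg hb.2) hc
    have h2 := mul_le_mul_of_nonneg_left ih (add_nonneg ha.1 hb.1)
    rw [Finset.prod_cons, Finset.prod_cons, Finset.prod_cons, Finset.card_cons, pow_succ,
      mul_mul_mul_comm]
    linarith

/-! ### Ordered eigenvalues, compressions and interlacing -/

theorem star_dotProduct_diagonal_mulVec {τ : Type*} [Fintype τ] [DecidableEq τ] (w : τ → ℝ)
    (v : τ → ℂ) : star v ⬝ᵥ (diagonal (fun i => (w i : ℂ)) *ᵥ v) =
      ((∑ i, w i * Complex.normSq (v i) : ℝ) : ℂ) := by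
  simp only [mulVec_diagonal, dotProduct, Pi.star_apply, Complex.ofReal_sum, Complex.ofReal_mul,
    Complex.normSq_eq_conj_mul_self, RCLike.star_def]
  exact Finset.sum_congr rfl fun i _ => by ring

/-- The min-max dimension count: as `T` is smaller than `S`, some nonzero `x` supported on `S` has
`M *ᵥ x` vanishing on `T`. The two diagonal forms agree there, and so do the norms. -/
theorem le_of_isometry_of_diagonal {ι κ : Type*} [Fintype ι] [DecidableEq ι] [Fintype κ]
    [DecidableEq κ] (M : Matrix ι κ ℂ) (a : ι → ℝ) (c : κ → ℝ) (hM : Mᴴ * M = 1)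
    (hac : Mᴴ * diagonal (fun i => (a i : ℂ)) * M = diagonal (fun i => (c i : ℂ)))
    (S : Finset κ) (T : Finset ι) (hST : T.card < S.card) (α γ : ℝ)
    (hS : ∀ i ∈ S, γ ≤ c i) (hT : ∀ s ∉ T, a s ≤ α) : γ ≤ α := by
  obtain ⟨y, hyker, hy⟩ : ∃ y ∈ LinearMap.ker
      (M.submatrix ((↑) : T → ι) ((↑) : S → κ)).mulVecLin, y ≠ 0 :=
    (Submodule.ne_bot_iff _).1 (LinearMap.ker_ne_bot_of_finrank_lt (by simpa using hST))
  have hyz : (M.submatrix ((↑) : T → ι) ((↑) : S → κ)) *ᵥ y = 0 := hyker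
  let x : κ → ℂ := fun i => if h : i ∈ S then y ⟨i, h⟩ else 0
  have hxS : ∀ i ∉ S, x i = 0 := fun i hi => dif_neg hi
  have hx : ∃ i, x i ≠ 0 := by
    obtain ⟨i, hi⟩ := Function.ne_iff.1 hy
    exact ⟨i, by simpa [x] using hi⟩
  have hzT : ∀ s ∈ T, (M *ᵥ x) s = 0 := by
    intro s hs
    have h := congrFun hyz ⟨s, hs⟩
    simp only [mulVec, dotProduct, submatrix_apply, Pi.zero_apply] at h ⊢
    rw [← h, ← Finset.sum_subset S.subset_univ (fun i _ hi => by simp [hxS i hi]),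
      ← Finset.sum_coe_sort S]
    simp [x]
  have pull : ∀ D : Matrix ι ι ℂ, star (M *ᵥ x) ⬝ᵥ (D *ᵥ (M *ᵥ x))
      = star x ⬝ᵥ ((Mᴴ * D * M) *ᵥ x) := by
    intro D
    rw [star_mulVec, ← dotProduct_mulVec, mulVec_mulVec, mulVec_mulVec, Matrix.mul_assoc]
  have e1 : ∑ i, a i * Complex.normSq ((M *ᵥ x) i) = ∑ i, c i * Complex.normSq (x i) := by
    have h := pull (diagonal fun i => (a i : ℂ))
    rw [hac, star_dotProduct_diagonal_mulVec, star_dotProduct_diagonal_mulVec] at h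
    exact_mod_cast h
  have e2 : ∑ i, Complex.normSq ((M *ᵥ x) i) = ∑ i, Complex.normSq (x i) := by
    have h := pull (diagonal fun _ => ((1 : ℝ) : ℂ))
    have h1 : (diagonal fun _ => ((1 : ℝ) : ℂ) : Matrix ι ι ℂ) = 1 := by simp
    have h2 : (1 : Matrix κ κ ℂ) = diagonal fun _ => ((1 : ℝ) : ℂ) := by simp
    rw [star_dotProduct_diagonal_mulVec, h1, Matrix.mul_one, hM, h2,
      star_dotProduct_diagonal_mulVec, Complex.ofReal_inj] at h
    simpa using h
  have hpos : 0 < ∑ i, Complex.normSq (x i) := by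
    obtain ⟨i, hi⟩ := hx
    exact Finset.sum_pos' (fun j _ => Complex.normSq_nonneg _)
      ⟨i, Finset.mem_univ i, Complex.normSq_pos.2 hi⟩
  have l1 : γ * ∑ i, Complex.normSq (x i) ≤ ∑ i, c i * Complex.normSq (x i) := by
    rw [Finset.mul_sum]
    refine Finset.sum_le_sum fun i _ => ?_
    by_cases hi : i ∈ S
    · exact mul_le_mul_of_nonneg_right (hS i hi) (Complex.normSq_nonneg _)
    · simp [hxS i hi]
  have l2 : ∑ i, a i * Complex.normSq ((M *ᵥ x) i)
      ≤ α * ∑ i, Complex.normSq ((M *ᵥ x) i) := by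
    rw [Finset.mul_sum]
    refine Finset.sum_le_sum fun i _ => ?_
    by_cases hi : i ∈ T
    · simp [hzT i hi]
    · exact mul_le_mul_of_nonneg_right (hT i hi) (Complex.normSq_nonneg _)
  rw [e1, e2] at l2
  exact le_of_mul_le_mul_right (l1.trans l2) hpos

theorem eigenvalueDesc_succ {n : ℕ} {A : Matrix (Fin n) (Fin n) ℂ} (hA : A.IsHermitian)
    (i : Fin n) :
    eigenvalueDesc hA (i + 1) = hA.eigenvalues₀ (Fin.cast (Fintype.card_fin n).symm i) := by
  rw [eigenvalueDesc, dif_pos ⟨by omega, by omega⟩]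
  rfl

theorem eigenvalueDesc_anti {n : ℕ} {A : Matrix (Fin n) (Fin n) ℂ} (hA : A.IsHermitian)
    {s t : ℕ} (hs : 1 ≤ s) (hst : s ≤ t) (ht : t ≤ n) :
    eigenvalueDesc hA t ≤ eigenvalueDesc hA s := by
  rw [eigenvalueDesc, eigenvalueDesc, dif_pos ⟨hs.trans hst, ht⟩, dif_pos ⟨hs, hst.trans ht⟩]
  exact hA.eigenvalues₀_antitone (by simp only [Fin.mk_le_mk]; omega)

/-- The enumeration of the eigenvalue indices in decreasing order of the eigenvalues. -/
noncomputable def eigenvalueEquiv (n : ℕ) : Fin n ≃ Fin n :=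
  (finCongr (Fintype.card_fin n).symm).trans (Fintype.equivOfCardEq (Fintype.card_fin _))

/-- `eigenvalues` reindexes the sorted `eigenvalues₀` by a chosen bijection, which `eigenvalueEquiv`
undoes. -/
theorem eigenvalues_eigenvalueEquiv {n : ℕ} {A : Matrix (Fin n) (Fin n) ℂ} (hA : A.IsHermitian)
    (i : Fin n) : hA.eigenvalues (eigenvalueEquiv n i) = eigenvalueDesc hA (i + 1) := by
  rw [eigenvalueDesc_succ, IsHermitian.eigenvalues, eigenvalueEquiv, Equiv.trans_apply,
    Equiv.symm_apply_apply]
  rfl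

theorem eigenvalueDesc_nonneg {n : ℕ} {A : Matrix (Fin n) (Fin n) ℂ} (hA : A.PosSemidef)
    (t : ℕ) : 0 ≤ eigenvalueDesc hA.isHermitian t := by
  by_cases h : 1 ≤ t ∧ t ≤ n
  · obtain ⟨s, rfl⟩ := Nat.exists_eq_add_of_le' h.1
    have h1 := eigenvalues_eigenvalueEquiv hA.isHermitian ⟨s, h.2⟩
    rw [← h1]
    exact hA.eigenvalues_nonneg _
  · rw [eigenvalueDesc, dif_neg h]

theorem exists_unitary_diagonalization {n : ℕ} {A : Matrix (Fin n) (Fin n) ℂ}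
    (hA : A.IsHermitian) : ∃ V : Matrix (Fin n) (Fin n) ℂ, Vᴴ * V = 1 ∧ V * Vᴴ = 1 ∧
      Vᴴ * A * V = diagonal (fun i : Fin n => (eigenvalueDesc hA (i + 1) : ℂ)) := by
  obtain ⟨⟨W, hW⟩, hWeq⟩ : ∃ W, W = hA.eigenvectorUnitary := ⟨_, rfl⟩
  have h1 : Wᴴ * W = 1 := hW.1
  have h2 : W * Wᴴ = 1 := hW.2
  have h3 : Wᴴ * A * W = diagonal (fun i => (hA.eigenvalues i : ℂ)) := by
    have h := hA.conjStarAlgAut_star_eigenvectorUnitary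
    rw [← hWeq, Unitary.conjStarAlgAut_star_apply] at h
    exact h
  refine ⟨W.submatrix id (eigenvalueEquiv n), ?_, ?_, ?_⟩
  · rw [conjTranspose_submatrix, ← submatrix_mul _ _ _ id _ Function.bijective_id, h1,
      submatrix_one_equiv]
  · rw [conjTranspose_submatrix, submatrix_mul_equiv, h2, submatrix_id_id]
  · rw [conjTranspose_submatrix]
    have h4 := congrArg (fun X => X.submatrix (eigenvalueEquiv n) (eigenvalueEquiv n)) h3
    simp only [submatrix_diagonal_equiv] at h4
    rw [submatrix_mul _ _ _ id _ Function.bijective_id,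
      submatrix_mul _ _ _ id _ Function.bijective_id, submatrix_id_id] at h4
    rw [h4]
    congr 1
    funext i
    simp [eigenvalues_eigenvalueEquiv]

theorem exists_isometry_compression_eq_diagonal {n m : ℕ} {A : Matrix (Fin n) (Fin n) ℂ}
    (hA : A.IsHermitian) (f : Fin m → Fin n) (hf : Function.Injective f) :
    ∃ U : Matrix (Fin n) (Fin m) ℂ, Uᴴ * U = 1 ∧
      Uᴴ * A * U = diagonal (fun i => (eigenvalueDesc hA (f i + 1) : ℂ)) := by
  obtain ⟨V, hV, -, hD⟩ := exists_unitary_diagonalization hA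
  refine ⟨V.submatrix id f, ?_, ?_⟩
  · rw [conjTranspose_submatrix, ← submatrix_mul _ _ _ id _ Function.bijective_id, hV,
      submatrix_one _ hf]
  · have h := congrArg (fun X => X.submatrix f f) hD
    simp only [submatrix_diagonal _ _ hf] at h
    rw [submatrix_mul _ _ _ id _ Function.bijective_id,
      submatrix_mul _ _ _ id _ Function.bijective_id, submatrix_id_id] at h
    rw [conjTranspose_submatrix, h]
    rfl

/-- **Cauchy interlacing** for the compression of a Hermitian matrix by an isometry. -/
theorem eigenvalueDesc_interlacing {n m : ℕ} {A : Matrix (Fin n) (Fin n) ℂ}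
    {C : Matrix (Fin m) (Fin m) ℂ} (hA : A.IsHermitian) (hC : C.IsHermitian) (hmn : m ≤ n)
    (U : Matrix (Fin n) (Fin m) ℂ) (hU : Uᴴ * U = 1) (hCU : Uᴴ * A * U = C) (i : Fin m) :
    eigenvalueDesc hA (n - m + i + 1) ≤ eigenvalueDesc hC (i + 1) ∧
      eigenvalueDesc hC (i + 1) ≤ eigenvalueDesc hA (i + 1) := by
  obtain ⟨V, -, hV, hVA⟩ := exists_unitary_diagonalization hA
  obtain ⟨W, hW, -, hWC⟩ := exists_unitary_diagonalization hC
  have hcancel : ∀ X : Matrix (Fin n) (Fin m) ℂ, V * (Vᴴ * X) = X := fun X => by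
    rw [← Matrix.mul_assoc, hV, Matrix.one_mul]
  have hM : (Vᴴ * U * W)ᴴ * (Vᴴ * U * W) = 1 := by
    simp only [conjTranspose_mul, conjTranspose_conjTranspose, Matrix.mul_assoc, hcancel]
    rw [← Matrix.mul_assoc Uᴴ, hU, Matrix.one_mul, hW]
  have hD : (Vᴴ * U * W)ᴴ * (Vᴴ * A * V) * (Vᴴ * U * W) = Wᴴ * C * W := by
    rw [← hCU]
    simp only [conjTranspose_mul, conjTranspose_conjTranspose, Matrix.mul_assoc, hcancel]
  have hi := i.2
  constructor
  -- Negation turns the lower bound into an upper one; the index sets have `m - i` and `m - i - 1`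
  -- elements.
  · refine neg_le_neg_iff.1 (le_of_isometry_of_diagonal (Vᴴ * U * W)
      (fun s => -eigenvalueDesc hA (s + 1)) (fun s => -eigenvalueDesc hC (s + 1)) hM ?_
      (Finset.Ici i) (Finset.Ioi ⟨n - m + i, by omega⟩) ?_ _ _ ?_ ?_)
    · rw [hVA, hWC] at hD
      simp only [Complex.ofReal_neg]
      rw [← Matrix.diagonal_neg, ← Matrix.diagonal_neg, ← hD, Matrix.mul_neg, Matrix.neg_mul]
    · rw [Fin.card_Ici, Fin.card_Ioi]
      simp only
      omega
    · intro s hs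
      have hs' : (i : ℕ) ≤ s := Fin.le_def.1 (Finset.mem_Ici.1 hs)
      exact neg_le_neg (eigenvalueDesc_anti hC (by omega) (by omega) (by omega))
    · intro s hs
      have hs' : (s : ℕ) ≤ n - m + i := not_lt.1 fun h => hs (Finset.mem_Ioi.2 h)
      exact neg_le_neg (eigenvalueDesc_anti hA (by omega) (by omega) (by omega))
  · refine le_of_isometry_of_diagonal (Vᴴ * U * W)
      (fun s => eigenvalueDesc hA (s + 1)) (fun s => eigenvalueDesc hC (s + 1)) hM ?_
      (Finset.Iic i) (Finset.Iio ⟨i, by omega⟩) ?_ _ _ ?_ ?_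
    · rw [← hVA, ← hWC, hD]
    · rw [Fin.card_Iic, Fin.card_Iio]
      simp
    · intro s hs
      have hs' : (s : ℕ) ≤ i := Fin.le_def.1 (Finset.mem_Iic.1 hs)
      exact eigenvalueDesc_anti hC (by omega) (by omega) (by omega)
    · intro s hs
      have hs' : (i : ℕ) ≤ s := not_lt.1 fun h => hs (Finset.mem_Iio.2 h)
      exact eigenvalueDesc_anti hA (by omega) (by omega) (by omega)

theorem trace_eq_sum_eigenvalueDesc {n : ℕ} {A : Matrix (Fin n) (Fin n) ℂ}
    (hA : A.IsHermitian) : A.trace = ((∑ i : Fin n, eigenvalueDesc hA (i + 1) : ℝ) : ℂ) := by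
  rw [hA.trace_eq_sum_eigenvalues, ← Equiv.sum_comp (eigenvalueEquiv n)]
  simp [eigenvalues_eigenvalueEquiv]

theorem det_eq_prod_eigenvalueDesc {n : ℕ} {A : Matrix (Fin n) (Fin n) ℂ}
    (hA : A.IsHermitian) : A.det = ((∏ i : Fin n, eigenvalueDesc hA (i + 1) : ℝ) : ℂ) := by
  rw [hA.det_eq_prod_eigenvalues, ← Equiv.prod_comp (eigenvalueEquiv n)]
  simp [eigenvalues_eigenvalueEquiv]

/-! ### Sums and products of eigenvalues of `A + B` -/

theorem sum_smallest_eigenvalueDesc_add_le {n : ℕ} {A B : Matrix (Fin n) (Fin n) ℂ}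
    (hA : A.IsHermitian) (hB : B.IsHermitian) (hAB : (A + B).IsHermitian) {j : ℕ} (hj : j ≤ n) :
    ∑ i : Fin j, (eigenvalueDesc hA (n - j + i + 1) + eigenvalueDesc hB (n - j + i + 1)) ≤
      ∑ i : Fin j, eigenvalueDesc hAB (n - j + i + 1) := by
  obtain ⟨U, hU, hD⟩ := exists_isometry_compression_eq_diagonal hAB
    (fun i : Fin j => (⟨n - j + i, by omega⟩ : Fin n))
    (fun a b h => Fin.ext (by simpa using h))
  have hX := isHermitian_conjTranspose_mul_mul U hA
  have hY := isHermitian_conjTranspose_mul_mul U hB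
  have htr := congrArg Matrix.trace hD
  rw [Matrix.mul_add, Matrix.add_mul, trace_add, trace_eq_sum_eigenvalueDesc hX,
    trace_eq_sum_eigenvalueDesc hY, trace_diagonal] at htr
  have htr' : ∑ i : Fin j, eigenvalueDesc hX (i + 1) + ∑ i : Fin j, eigenvalueDesc hY (i + 1) =
      ∑ i : Fin j, eigenvalueDesc hAB (n - j + i + 1) := by exact_mod_cast htr
  rw [← htr', ← Finset.sum_add_distrib]
  exact Finset.sum_le_sum fun i _ => add_le_add
    (eigenvalueDesc_interlacing hA hX hj U hU rfl i).1
    (eigenvalueDesc_interlacing hB hY hj U hU rfl i).1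

theorem prod_Icc_eq_prod_fin (f : ℕ → ℝ) {n k : ℕ} (hkn : k ≤ n) :
    ∏ t ∈ Finset.Icc (n - k + 1) n, f t = ∏ i : Fin k, f (n - k + i + 1) := by
  rw [Fin.prod_univ_eq_prod_range (fun i => f (n - k + i + 1)) k,
    ← Finset.Ico_add_one_right_eq_Icc, Finset.prod_Ico_eq_prod_range]
  refine Finset.prod_congr (by congr 1; omega) fun i _ => by congr 1; omega

theorem prod_range_sub_eq_prod_fin (f : ℕ → ℝ) {n k : ℕ} (hkn : k ≤ n) :
    ∏ i ∈ Finset.range k, f (n - i) = ∏ i : Fin k, f (n - k + i + 1) := by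
  rw [Fin.prod_univ_eq_prod_range (fun i => f (n - k + i + 1)) k, ← Finset.prod_range_reflect]
  refine Finset.prod_congr rfl fun i hi => ?_
  have := Finset.mem_range.1 hi
  congr 1
  omega

theorem sum_range_sub_eq_sum_fin (f : ℕ → ℝ) {n k : ℕ} (hkn : k ≤ n) :
    ∑ i ∈ Finset.range k, f (n - i) = ∑ i : Fin k, f (n - k + i + 1) := by
  rw [Fin.sum_univ_eq_sum_range (fun i => f (n - k + i + 1)) k, ← Finset.sum_range_reflect]
  refine Finset.sum_congr rfl fun i hi => ?_
  have := Finset.mem_range.1 hi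
  congr 1
  omega

theorem prod_smallest_eigenvalueDesc_add_le {n k : ℕ} (hkn : k ≤ n)
    {A B : Matrix (Fin n) (Fin n) ℂ} (hA : A.PosSemidef) (hB : B.PosSemidef) :
    ∏ i : Fin k, (eigenvalueDesc hA.isHermitian (n - k + i + 1)
        + eigenvalueDesc hB.isHermitian (n - k + i + 1)) ≤
      ∏ i : Fin k, eigenvalueDesc (hA.add hB).isHermitian (n - k + i + 1) := by
  rw [← prod_range_sub_eq_prod_fin _ hkn, ← prod_range_sub_eq_prod_fin
    (fun t => eigenvalueDesc hA.isHermitian t + eigenvalueDesc hB.isHermitian t) hkn]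
  -- Indexed by `n - i`, the eigenvalues increase with `i`, and the partial sums are those of the
  -- `j` smallest.
  refine prod_le_prod_of_partial_sums_le _ _ k ?_ ?_ ?_
  · exact fun i j hij hj => eigenvalueDesc_anti _ (by omega) (by omega) (by omega)
  · exact fun i _ => add_nonneg (eigenvalueDesc_nonneg hA _) (eigenvalueDesc_nonneg hB _)
  · intro j hj
    rw [sum_range_sub_eq_sum_fin _ (hj.trans hkn), sum_range_sub_eq_sum_fin
      (fun t => eigenvalueDesc hA.isHermitian t + eigenvalueDesc hB.isHermitian t)
      (hj.trans hkn)]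
    exact sum_smallest_eigenvalueDesc_add_le _ _ _ (hj.trans hkn)

theorem prod_mul_rpow_half {ι : Type*} (s : Finset ι) (a b : ι → ℝ) (ha : ∀ i ∈ s, 0 ≤ a i)
    (hb : ∀ i ∈ s, 0 ≤ b i) :
    ∏ i ∈ s, (a i * b i) ^ (1 / 2 : ℝ) = √((∏ i ∈ s, a i) * ∏ i ∈ s, b i) := by
  rw [Real.finsetProd_rpow _ _ (fun i hi => mul_nonneg (ha i hi) (hb i hi)),
    Finset.prod_mul_distrib, Real.sqrt_eq_rpow]

/-- Lower bounds `p`, `q` replace the exact products because interlacing only bounds the determinant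
of the compressed `B`; the left side is monotone in them as `2 ^ k - 2 ≥ 0`. -/
theorem prod_eigenvalueDesc_add_ge {k : ℕ} (hk : 1 ≤ k)
    {X Y : Matrix (Fin k) (Fin k) ℂ} (hX : X.PosSemidef) (hY : Y.PosSemidef) {p q : ℝ} (hp : 0 ≤ p) (hq : 0 ≤ q)
    (hpX : p ≤ ∏ i : Fin k, eigenvalueDesc hX.isHermitian (i + 1))
    (hqY : q ≤ ∏ i : Fin k, eigenvalueDesc hY.isHermitian (i + 1)) :
    p + q + ((2 : ℝ) ^ k - 2) * √(p * q) ≤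
      ∏ i : Fin k, eigenvalueDesc (hX.add hY).isHermitian (i + 1) := by
  have hne : (Finset.univ : Finset (Fin k)).Nonempty := ⟨⟨0, hk⟩, Finset.mem_univ _⟩
  have h1 := prod_smallest_eigenvalueDesc_add_le le_rfl hX hY
  simp only [Nat.sub_self, Nat.zero_add] at h1
  have h2 := prod_add_ge_prod_add_prod_add_sqrt Finset.univ hne
    (fun i : Fin k => eigenvalueDesc hX.isHermitian (i + 1))
    (fun i : Fin k => eigenvalueDesc hY.isHermitian (i + 1))
    (fun _ _ => eigenvalueDesc_nonneg hX _) (fun _ _ => eigenvalueDesc_nonneg hY _)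
  rw [Finset.card_univ, Fintype.card_fin] at h2
  have hc : (0 : ℝ) ≤ 2 ^ k - 2 := by
    have := pow_le_pow_right₀ (one_le_two (α := ℝ)) hk
    linarith
  have h3 := mul_le_mul_of_nonneg_left
    (Real.sqrt_le_sqrt (mul_le_mul hpX hqY hq (hp.trans hpX))) hc
  linarith

theorem prod_largest_eigenvalueDesc_add_ge {n k : ℕ} (hk : 1 ≤ k) (hkn : k ≤ n)
    {A B : Matrix (Fin n) (Fin n) ℂ} (hA : A.PosSemidef) (hB : B.PosSemidef) :
    (∏ i : Fin k, eigenvalueDesc hA.isHermitian (i + 1))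
        + (∏ i : Fin k, eigenvalueDesc hB.isHermitian (n - k + i + 1))
        + ((2 : ℝ) ^ k - 2) * √((∏ i : Fin k, eigenvalueDesc hA.isHermitian (i + 1))
          * ∏ i : Fin k, eigenvalueDesc hB.isHermitian (n - k + i + 1)) ≤
      ∏ i : Fin k, eigenvalueDesc (hA.add hB).isHermitian (i + 1) := by
  obtain ⟨U, hU, hD⟩ := exists_isometry_compression_eq_diagonal hA.isHermitian
    (Fin.castLE hkn) (Fin.castLE_injective hkn)
  have hX := hA.conjTranspose_mul_mul_same U
  have hY := hB.conjTranspose_mul_mul_same U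
  have hdet := congrArg Matrix.det hD
  rw [det_eq_prod_eigenvalueDesc hX.isHermitian, det_diagonal] at hdet
  have hdet' : ∏ i : Fin k, eigenvalueDesc hX.isHermitian (i + 1) =
      ∏ i : Fin k, eigenvalueDesc hA.isHermitian (i + 1) := by exact_mod_cast hdet
  refine (prod_eigenvalueDesc_add_ge hk hX hY
    (Finset.prod_nonneg fun _ _ => eigenvalueDesc_nonneg hA _)
    (Finset.prod_nonneg fun _ _ => eigenvalueDesc_nonneg hB _) hdet'.ge ?_).trans ?_
  · exact Finset.prod_le_prod (fun _ _ => eigenvalueDesc_nonneg hB _) fun i _ =>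
      (eigenvalueDesc_interlacing hB.isHermitian hY.isHermitian hkn U hU rfl i).1
  · exact Finset.prod_le_prod (fun _ _ => eigenvalueDesc_nonneg (hX.add hY) _) fun i _ =>
      (eigenvalueDesc_interlacing (hA.add hB).isHermitian (hX.add hY).isHermitian hkn U hU
        (by rw [Matrix.mul_add, Matrix.add_mul]) i).2

theorem mainTheorem6 (n k : ℕ) (hk : 1 ≤ k) (hkn : k ≤ n)
    (A B : Matrix (Fin n) (Fin n) ℂ) (hA : A.PosSemidef) (hB : B.PosSemidef) :
    ((∏ t ∈ Finset.Icc (n - k + 1) n, eigenvalueDesc (hA.add hB).isHermitian t) ≥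
        ∏ t ∈ Finset.Icc (n - k + 1) n,
          (eigenvalueDesc hA.isHermitian t + eigenvalueDesc hB.isHermitian t)) ∧
    ((∏ t ∈ Finset.Icc (n - k + 1) n,
          (eigenvalueDesc hA.isHermitian t + eigenvalueDesc hB.isHermitian t)) ≥
        (∏ t ∈ Finset.Icc (n - k + 1) n, eigenvalueDesc hA.isHermitian t)
          + (∏ t ∈ Finset.Icc (n - k + 1) n, eigenvalueDesc hB.isHermitian t)
          + ((2 : ℝ) ^ k - 2) * ∏ t ∈ Finset.Icc (n - k + 1) n,
              (eigenvalueDesc hA.isHermitian t * eigenvalueDesc hB.isHermitian t)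
                ^ (1 / 2 : ℝ)) ∧
    ((∏ t ∈ Finset.Icc 1 k, eigenvalueDesc (hA.add hB).isHermitian t) ≥
        (∏ t ∈ Finset.Icc 1 k, eigenvalueDesc hA.isHermitian t)
          + (∏ t ∈ Finset.Icc 1 k, eigenvalueDesc hB.isHermitian (n - t + 1))
          + ((2 : ℝ) ^ k - 2) * ∏ t ∈ Finset.Icc 1 k,
              (eigenvalueDesc hA.isHermitian t * eigenvalueDesc hB.isHermitian (n - t + 1))
                ^ (1 / 2 : ℝ)) := by
  have hne : (Finset.Icc (n - k + 1) n).Nonempty := Finset.nonempty_Icc.2 (by omega)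
  have hcard : (Finset.Icc (n - k + 1) n).card = k := by rw [Nat.card_Icc]; omega
  refine ⟨?_, ?_, ?_⟩
  · rw [ge_iff_le, prod_Icc_eq_prod_fin _ hkn, prod_Icc_eq_prod_fin _ hkn]
    exact prod_smallest_eigenvalueDesc_add_le hkn hA hB
  · have h := prod_add_ge_prod_add_prod_add_sqrt _ hne (eigenvalueDesc hA.isHermitian)
      (eigenvalueDesc hB.isHermitian) (fun _ _ => eigenvalueDesc_nonneg hA _)
      (fun _ _ => eigenvalueDesc_nonneg hB _)
    rw [hcard] at h
    rw [ge_iff_le, prod_mul_rpow_half _ _ _ (fun _ _ => eigenvalueDesc_nonneg hA _)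
      (fun _ _ => eigenvalueDesc_nonneg hB _)]
    exact h
  · have hIcc : ∀ f : ℕ → ℝ, ∏ t ∈ Finset.Icc 1 k, f t = ∏ i : Fin k, f (i + 1) := fun f => by
      simpa using prod_Icc_eq_prod_fin f le_rfl
    have hrev : ∏ t ∈ Finset.Icc 1 k, eigenvalueDesc hB.isHermitian (n - t + 1) =
        ∏ i : Fin k, eigenvalueDesc hB.isHermitian (n - k + i + 1) := by
      rw [hIcc, ← prod_range_sub_eq_prod_fin _ hkn,
        Fin.prod_univ_eq_prod_range
          (fun i => eigenvalueDesc hB.isHermitian (n - (i + 1) + 1)) k]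
      refine Finset.prod_congr rfl fun i hi => ?_
      have := Finset.mem_range.1 hi
      congr 1
      omega
    rw [ge_iff_le, prod_mul_rpow_half _ _ _ (fun _ _ => eigenvalueDesc_nonneg hA _)
      (fun _ _ => eigenvalueDesc_nonneg hB _), hrev, hIcc, hIcc]
    exact prod_largest_eigenvalueDesc_add_ge hk hkn hA hB
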